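/- Let $X$ be a topological space and $\lambda$ a family of subsets of $X$. For a non-closed set $A\subseteq X$ and a point $x\in\overline{A}\setminus A$, the Asanov–Velichko game generated by $\lambda$ is played as follows: at step $n\in\mathbb N$, player ONE chooses an open neighborhood $V_n$ of $x$, and then player TWO chooses a set $S_n\subseteq A$ such that $S_n\subseteq\overline{T_n}$ for some $T_n\in\lambda$. Player TWO wins if $\overline{\bigcup_{n} S_n}\cap\bigcap_{n} V_n\neq\emptyset$; otherwise player ONE wins. The space $X$ is an $AV_\lambda$-space if for every non-closed $A\subseteq X$ there is a point $x\in\overline{A}\setminus A$ for which player TWO has a winning strategy in this game. Let $\sigma\lambda$ denote the family of all countable unions of elements of $\lambda$. Let $C_{\lambda,\rho}(X)$ denote the set of all continuous functions $X\to\mathbb R$ with the topology of uniform convergence on the elements of $\lambda$, i.e. the topology of the uniformity generated by the sets $\{(f,g): |f(x)-g(x)|<\varepsilon \text{ for all } x\in B\}$ with $B\in\lambda$ and $\varepsilon>0$. A subset $F$ of a space $Z$ is bounded if every continuous function $Z\to\mathbb R$ is bounded on $F$, and $Z$ is a $\mu$-space if every bounded subset of $Z$ has compact closure in $Z$. Theorem.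 Let $X$ be a Tychonoff space and let $\lambda$ be a cover of $X$ such that $X$ is an $AV_{\sigma\lambda}$-space. Then $C_{\lambda,\rho}(X)$ is a $\mu$-space. -/

import Mathlib

open Set Topology

/-- The family `σ𝔖` of all countable unions of elements of `𝔖`. -/
def sigmaFamily {X : Type*} (𝔖 : Set (Set X)) : Set (Set X) :=
  {T | ∃ 𝒜 : Set (Set X), 𝒜 ⊆ 𝔖 ∧ 𝒜.Countable ∧ T = ⋃₀ 𝒜}

/-- The set of continuous maps `X → Y`, as a type on which we put the uniformity of uniform
convergence on the elements of `𝔖`. -/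
def UniformOnC (X Y : Type*) [TopologicalSpace X] [TopologicalSpace Y]
    (_ : Set (Set X)) : Type _ :=
  C(X, Y)

/-- The uniformity on `C(X, Y)` generated by the sets
`{(f, g) | ∀ x ∈ A, (f x, g x) ∈ M}`, for `A ∈ 𝔖` and `M` an entourage of `Y`. Its topology is the
topology of uniform convergence on the elements of `𝔖`. -/
instance UniformOnC.instUniformSpace (X Y : Type*) [TopologicalSpace X] [UniformSpace Y]
    (𝔖 : Set (Set X)) : UniformSpace (UniformOnC X Y 𝔖) :=
  UniformSpace.comap (fun f : C(X, Y) => UniformOnFun.ofFun 𝔖 (f : X → Y)) inferInstance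

/-- A subset `F` of a space `Z` is bounded (in `Z`) if every continuous real-valued function on `Z`
is bounded on `F`. -/
def IsFunctionallyBounded {Z : Type*} [TopologicalSpace Z] (F : Set Z) : Prop :=
  ∀ φ : C(Z, ℝ), Bornology.IsBounded (φ '' F)

/-- A `μ`-space: every bounded subset has compact closure. -/
def IsMuSpace (Z : Type*) [TopologicalSpace Z] : Prop :=
  ∀ F : Set Z, IsFunctionallyBounded F → IsCompact (closure F)

/-- A strategy of player TWO assigns to the list `[V 0, …, V n]` of all moves that player ONE has
made so far the answer `S n` of player TWO at step `n`. -/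
abbrev TwoStrategy (X : Type*) : Type _ := List (Set X) → Set X

/-- The answer at step `n` of player TWO following the strategy `s`, if player ONE plays `V`. -/
def TwoStrategy.answer {X : Type*} (s : TwoStrategy X) (V : ℕ → Set X) (n : ℕ) : Set X :=
  s ((List.range (n + 1)).map V)

/-- `s` is a winning strategy of player TWO in the Asanov–Velichko game generated by `𝔖`, played for
the set `A` at the point `x`: whatever open neighborhoods `V n` of `x` player ONE plays, the answers
`S n` given by `s` are legal (`S n` is a subset of `A` that lies in the closure of an element
of `𝔖`), and the closure of `⋃ n, S n` meets `⋂ n, V n`. -/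
def IsWinningForTwo {X : Type*} [TopologicalSpace X] (𝔖 : Set (Set X)) (A : Set X) (x : X)
    (s : TwoStrategy X) : Prop :=
  ∀ V : ℕ → Set X, (∀ n, IsOpen (V n) ∧ x ∈ V n) →
    (∀ n, s.answer V n ⊆ A ∧ ∃ T ∈ 𝔖, s.answer V n ⊆ closure T) ∧
    (closure (⋃ n, s.answer V n) ∩ ⋂ n, V n).Nonempty

/-- `X` is Asanov–Velichko generated by the family `𝔖` (an `AV_𝔖`-space). -/
def IsAVSpace (X : Type*) [TopologicalSpace X] (𝔖 : Set (Set X)) : Prop :=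
  ∀ A : Set X, ¬ IsClosed A →
    ∃ x ∈ closure A \ A, ∃ s : TwoStrategy X, IsWinningForTwo 𝔖 A x s

/-!
Let `F` be a bounded subset of `UniformOnC X ℝ 𝔖` and `𝓤` an ultrafilter containing `F`; the task is
to find a limit of `𝓤`.

For a *countable* `𝒜 ⊆ 𝔖` the space `UniformOnC X ℝ 𝒜` has a countably generated uniformity, and in
such a space bounded sets have compact closure (`IsFunctionallyBounded.isCompact_closure`): if a
sequence `u` has no cluster point, the reciprocal of the distance from `(z, 0)` to the set of all
`(u n, 1 / (n + 1))` is a continuous function of `z` that is unbounded along `u`. Hence every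
ultrafilter containing `F` converges, uniformly on each element of `𝒜`, to some *continuous*
function (`IsFunctionallyBounded.exists_tendstoUniformlyOn`).

As `𝔖` covers `X`, `𝓤` has a pointwise limit `g`, the convergence is uniform on each element of `𝔖`,
and `g` agrees with a continuous function on the closure of any countable union of elements of `𝔖`.
What is left is the continuity of `g` (`continuous_of_forall_countable`). If the preimage `A` of a
closed set were not closed, TWO would have a winning strategy at some `x ∈ closure A \ A`. Player ONE
picks at step `n` a function `h n ∈ F` that is `1 / (n + 1)`-close to `g` at `x` and on the first `n`
elements of `𝔖` involved in each of the first `n` answers of TWO, and plays the set where `h n` is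
`1 / (n + 1)`-close to `h n x`. TWO's victory provides `y` with `h n y - h n x → 0` in the closure of
the union of the answers. A limit `f` of `h` along a nonprincipal ultrafilter, continuous and
obtained from a countable subfamily that also covers `x` and `y`, then agrees with `g` on all
answers and at `x`, and `f y = f x`; so `g x = f y` lies in the closed set, a contradiction.
-/

open Filter Uniformity

/-! ### Bounded sets in uniform spaces with a countably generated uniformity -/

theorem IsFunctionallyBounded.image {Z W : Type*} [TopologicalSpace Z] [TopologicalSpace W]
    {F : Set Z} (hF : IsFunctionallyBounded F) {p : Z → W} (hp : Continuous p) :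
    IsFunctionallyBounded (p '' F) := by
  intro φ
  rw [Set.image_image]
  exact hF (φ.comp ⟨p, hp⟩)

theorem IsFunctionallyBounded.closure {Z : Type*} [TopologicalSpace Z] {F : Set Z}
    (hF : IsFunctionallyBounded F) : IsFunctionallyBounded (closure F) := fun φ =>
  (hF φ).closure.subset (image_closure_subset_closure_image φ.continuous)

theorem IsFunctionallyBounded.exists_mapClusterPt {M : Type*} [PseudoMetricSpace M] {F : Set M}
    (hF : IsFunctionallyBounded F) {u : ℕ → M} (hu : ∀ n, u n ∈ F) :
    ∃ a, MapClusterPt a atTop u := by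
  by_contra! hno
  set P : Set (M × ℝ) := Set.range fun n : ℕ => (u n, 1 / ((n : ℝ) + 1))
  have hP : P.Nonempty := Set.range_nonempty _
  have hcont : Continuous fun z : M => Metric.infDist (z, (0 : ℝ)) P :=
    (Metric.continuous_infDist_pt P).comp (by fun_prop)
  have hne : ∀ z : M, Metric.infDist (z, (0 : ℝ)) P ≠ 0 := by
    intro z hz
    refine hno z ?_
    rw [Metric.nhds_basis_ball.mapClusterPt_iff_frequently]
    intro ε hε
    rw [frequently_atTop]
    intro N
    -- closeness of `1 / (n + 1)` to `0` within `1 / (N + 1)` forces the index to be large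
    have hδ : (0 : ℝ) < min ε (1 / ((N : ℝ) + 1)) := lt_min hε Nat.one_div_pos_of_nat
    have hlt : Metric.infDist (z, (0 : ℝ)) P < min ε (1 / ((N : ℝ) + 1)) := by rwa [hz]
    obtain ⟨_, ⟨n, rfl⟩, hn⟩ := (Metric.infDist_lt_iff hP).1 hlt
    rw [Prod.dist_eq, max_lt_iff, lt_min_iff, lt_min_iff] at hn
    refine ⟨n, ?_, ?_⟩
    · have h1 := hn.2.2
      have hpos : (0 : ℝ) < 1 / ((n : ℝ) + 1) := Nat.one_div_pos_of_nat
      rw [Real.dist_eq, zero_sub, abs_neg, abs_of_pos hpos] at h1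
      have h2 := lt_of_one_div_lt_one_div (by positivity : (0 : ℝ) < (n : ℝ) + 1) h1
      have h3 : (N : ℝ) < n := by linarith
      exact le_of_lt (by exact_mod_cast h3)
    · rw [Metric.mem_ball, dist_comm]
      exact hn.1.1
  obtain ⟨C, hC⟩ := (hF ⟨fun z => (Metric.infDist (z, (0 : ℝ)) P)⁻¹, hcont.inv₀ hne⟩).exists_norm_le
  obtain ⟨n, hn⟩ := exists_nat_gt C
  have hpos : 0 < Metric.infDist (u n, (0 : ℝ)) P :=
    lt_of_le_of_ne Metric.infDist_nonneg (hne _).symm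
  have hle : Metric.infDist (u n, (0 : ℝ)) P ≤ 1 / ((n : ℝ) + 1) := by
    refine (Metric.infDist_le_dist_of_mem (Set.mem_range_self n)).trans_eq ?_
    rw [Prod.dist_eq, dist_self, Real.dist_eq, zero_sub, abs_neg,
      abs_of_pos Nat.one_div_pos_of_nat]
    exact max_eq_right Nat.one_div_pos_of_nat.le
  have h1 : (Metric.infDist (u n, (0 : ℝ)) P)⁻¹ ≤ C :=
    (le_abs_self _).trans (hC _ ⟨u n, hu n, rfl⟩)
  have h2 : (n : ℝ) + 1 ≤ (Metric.infDist (u n, (0 : ℝ)) P)⁻¹ := by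
    rw [le_inv_comm₀ (by positivity) hpos, ← one_div]
    exact hle
  linarith

theorem IsFunctionallyBounded.isCompact_closure {M : Type*} [UniformSpace M]
    [IsCountablyGenerated (𝓤 M)] {F : Set M} (hF : IsFunctionallyBounded F) :
    IsCompact (_root_.closure F) := by
  let _ := UniformSpace.pseudoMetricSpace M
  rw [isCompact_iff_isSeqCompact]
  intro u hu
  obtain ⟨a, ha⟩ := hF.closure.exists_mapClusterPt hu
  obtain ⟨ψ, hψ, hlim⟩ := ha.tendsto_subseq
  exact ⟨a, isClosed_closure.mem_of_tendsto hlim (Eventually.of_forall fun n => hu _), ψ, hψ, hlim⟩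

/-! ### Uniform convergence on the elements of a family -/

/-- Forgets the family of sets on which convergence is uniform. -/
def UniformOnC.toC {X Y : Type*} [TopologicalSpace X] [TopologicalSpace Y] {𝔖 : Set (Set X)}
    (h : UniformOnC X Y 𝔖) : C(X, Y) := h

/-- Regards a continuous map as a point of the space of uniform convergence on elements of `𝔖`. -/
def UniformOnC.ofC {X Y : Type*} [TopologicalSpace X] [TopologicalSpace Y] (𝔖 : Set (Set X))
    (f : C(X, Y)) : UniformOnC X Y 𝔖 := f

theorem UniformOnC.tendsto_iff_tendstoUniformlyOn {X Y ι : Type*} [TopologicalSpace X]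
    [UniformSpace Y] {𝔖 : Set (Set X)} {p : Filter ι} {u : ι → UniformOnC X Y 𝔖}
    {f : UniformOnC X Y 𝔖} :
    Tendsto u p (𝓝 f) ↔ ∀ T ∈ 𝔖, TendstoUniformlyOn (fun i x => (u i).toC x) f.toC p T := by
  have hind : IsInducing fun h : UniformOnC X Y 𝔖 => UniformOnFun.ofFun 𝔖 (h.toC : X → Y) := ⟨rfl⟩
  rw [hind.tendsto_nhds_iff, UniformOnFun.tendsto_iff_tendstoUniformlyOn]
  rfl

theorem UniformOnC.isCountablyGenerated_uniformity {X Y : Type*} [TopologicalSpace X]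
    [UniformSpace Y] [IsCountablyGenerated (𝓤 Y)] {𝒜 : Set (Set X)} (h𝒜 : 𝒜.Countable) :
    IsCountablyGenerated (𝓤 (UniformOnC X Y 𝒜)) := by
  have : Countable 𝒜 := h𝒜
  have hfun : IsCountablyGenerated (𝓤 (UniformOnFun X Y 𝒜)) := by
    obtain ⟨V, hV⟩ := exists_antitone_basis (𝓤 Y)
    rw [UniformOnFun.uniformity_eq_of_basis Y 𝒜 hV.1, iInf_subtype']
    infer_instance
  exact Filter.comap.isCountablyGenerated _ _

theorem UniformOnC.continuous_restrict_family {X Y : Type*} [TopologicalSpace X]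
    [UniformSpace Y] {𝒜 𝔖 : Set (Set X)} (h𝒜 : 𝒜 ⊆ 𝔖) :
    Continuous fun h : UniformOnC X Y 𝔖 => UniformOnC.ofC 𝒜 h.toC :=
  continuous_iff_continuousAt.2 fun _ => UniformOnC.tendsto_iff_tendstoUniformlyOn.2 fun T hT =>
    UniformOnC.tendsto_iff_tendstoUniformlyOn (𝔖 := 𝔖).1 tendsto_id T (h𝒜 hT)

/-- On countably many elements of `𝔖`, an ultrafilter containing a bounded set has a limit, and this
limit is continuous on all of `X`. -/
theorem IsFunctionallyBounded.exists_tendstoUniformlyOn {X : Type*} [TopologicalSpace X]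
    {𝔖 : Set (Set X)} {F : Set (UniformOnC X ℝ 𝔖)} (hF : IsFunctionallyBounded F)
    {𝒰 : Ultrafilter (UniformOnC X ℝ 𝔖)} (h𝒰 : F ∈ 𝒰) {𝒜 : Set (Set X)} (h𝒜 : 𝒜 ⊆ 𝔖)
    (hc : 𝒜.Countable) :
    ∃ f : C(X, ℝ), ∀ T ∈ 𝒜,
      TendstoUniformlyOn (fun (h : UniformOnC X ℝ 𝔖) x => h.toC x) f 𝒰 T := by
  set r : UniformOnC X ℝ 𝔖 → UniformOnC X ℝ 𝒜 := fun h => .ofC 𝒜 h.toC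
  have := UniformOnC.isCountablyGenerated_uniformity (Y := ℝ) hc
  have hcomp := (hF.image (UniformOnC.continuous_restrict_family h𝒜)).isCompact_closure
  obtain ⟨f, -, hf⟩ := isCompact_iff_ultrafilter_le_nhds'.1 hcomp (𝒰.map r)
    (mem_of_superset (image_mem_map h𝒰) subset_closure)
  exact ⟨f.toC, UniformOnC.tendsto_iff_tendstoUniformlyOn.1 (show Tendsto r 𝒰 (𝓝 f) from hf)⟩

/-! ### The game -/

/-- If player ONE decides on each move by looking at the previous ones, this produces a play. -/
theorem exists_play {α : Type*} (next : List α → α) :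
    ∃ V : ℕ → α, ∀ n, V n = next ((List.range n).map V) := by
  let L : ℕ → List α := fun n => Nat.rec [] (fun _ l => l ++ [next l]) n
  refine ⟨fun n => next (L n), fun n => congrArg next ?_⟩
  induction n with
  | zero => rfl
  | succ n ih =>
    rw [List.range_succ, List.map_append, ← ih]
    rfl

theorem exists_seq_subset_closure_iUnion {X : Type*} [TopologicalSpace X] {𝔖 : Set (Set X)}
    (hne : 𝔖.Nonempty) (S : Set X) :
    ∃ e : ℕ → Set X, (∀ k, e k ∈ 𝔖) ∧
      ((∃ T ∈ sigmaFamily 𝔖, S ⊆ closure T) → S ⊆ closure (⋃ k, e k)) := by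
  obtain ⟨T₀, hT₀⟩ := hne
  by_cases h : ∃ T ∈ sigmaFamily 𝔖, S ⊆ closure T
  · obtain ⟨_, ⟨𝒜, h𝒜, hc, rfl⟩, hS⟩ := h
    -- inserting `T₀` makes the countable family nonempty, hence the range of a sequence
    obtain ⟨e, he⟩ := (hc.insert T₀).exists_eq_range (Set.insert_nonempty _ _)
    refine ⟨e, fun k => Set.insert_subset hT₀ h𝒜 (he ▸ Set.mem_range_self k), fun _ => ?_⟩
    rw [← Set.sUnion_range, ← he]
    exact hS.trans (closure_mono (Set.sUnion_mono (Set.subset_insert _ _)))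
  · exact ⟨fun _ => T₀, fun _ => hT₀, fun h' => absurd h' h⟩

/-- A function that agrees with continuous functions on countable unions of elements of a cover does
so on the closures of these unions. -/
theorem eqOn_closure_of_forall_countable {X : Type*} [TopologicalSpace X] {𝔖 : Set (Set X)}
    (hcover : ⋃₀ 𝔖 = Set.univ) {g : X → ℝ}
    (hg : ∀ 𝒜 ⊆ 𝔖, 𝒜.Countable → ∃ f : C(X, ℝ), Set.EqOn g f (⋃₀ 𝒜)) {e : ℕ → Set X}
    (he : ∀ k, e k ∈ 𝔖) {f : C(X, ℝ)} (hf : Set.EqOn g f (⋃ k, e k)) :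
    Set.EqOn g f (closure (⋃ k, e k)) := by
  intro y hy
  obtain ⟨Y, hY, hyY⟩ : y ∈ ⋃₀ 𝔖 := hcover ▸ Set.mem_univ y
  obtain ⟨f', hf'⟩ := hg (insert Y (Set.range e))
    (Set.insert_subset hY (Set.range_subset_iff.2 he)) ((Set.countable_range e).insert Y)
  have hff' : Set.EqOn f f' (⋃ k, e k) := fun z hz =>
    (hf hz).symm.trans (hf' (by
      rw [Set.sUnion_insert, Set.sUnion_range]
      exact Or.inr hz))
  rw [hff'.closure f.continuous f'.continuous hy]
  exact hf' ⟨Y, Set.mem_insert _ _, hyY⟩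

/-- The limit, uniform on the elements of `𝔖`, of an ultrafilter containing a bounded set is
continuous in an Asanov–Velichko space. -/
theorem continuous_of_forall_countable {X : Type*} [TopologicalSpace X] {𝔖 : Set (Set X)}
    (hcover : ⋃₀ 𝔖 = Set.univ) (hAV : IsAVSpace X (sigmaFamily 𝔖))
    {F : Set (UniformOnC X ℝ 𝔖)} (hF : IsFunctionallyBounded F)
    {𝒰 : Ultrafilter (UniformOnC X ℝ 𝔖)} (h𝒰 : F ∈ 𝒰) {g : X → ℝ}
    (hlim : ∀ T ∈ 𝔖, TendstoUniformlyOn (fun (h : UniformOnC X ℝ 𝔖) x => h.toC x) g 𝒰 T)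
    (hg : ∀ 𝒜 ⊆ 𝔖, 𝒜.Countable → ∃ f : C(X, ℝ), Set.EqOn g f (⋃₀ 𝒜)) : Continuous g := by
  refine continuous_iff_isClosed.2 fun C hC => ?_
  by_contra hA
  obtain ⟨x, ⟨-, hxA⟩, s, hs⟩ := hAV _ hA
  obtain ⟨Tx, hTx, hxTx⟩ : x ∈ ⋃₀ 𝔖 := hcover ▸ Set.mem_univ x
  choose e he𝔖 he using exists_seq_subset_closure_iUnion (X := X) (𝔖 := 𝔖) ⟨Tx, hTx⟩
  -- the function of `F` behind the move of ONE, given the list of the previous moves of ONE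
  have hex : ∀ L : List (Set X), ∃ h ∈ F,
      (∀ z ∈ Tx, dist (g z) (h.toC z) < 1 / ((L.length : ℝ) + 1)) ∧
      ∀ i < L.length, ∀ k < L.length, ∀ z ∈ e (s (L.take (i + 1))) k,
        dist (g z) (h.toC z) < 1 / ((L.length : ℝ) + 1) := by
    intro L
    have hpos : (0 : ℝ) < 1 / ((L.length : ℝ) + 1) := Nat.one_div_pos_of_nat
    have h1 := Metric.tendstoUniformlyOn_iff.1 (hlim Tx hTx) _ hpos
    have h2 : ∀ᶠ h : UniformOnC X ℝ 𝔖 in (𝒰 : Filter _), ∀ i ∈ Set.Iio L.length,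
        ∀ k ∈ Set.Iio L.length, ∀ z ∈ e (s (L.take (i + 1))) k,
          dist (g z) (h.toC z) < 1 / ((L.length : ℝ) + 1) :=
      (eventually_all_finite (Set.finite_Iio _)).2 fun i _ =>
        (eventually_all_finite (Set.finite_Iio _)).2 fun k _ =>
          Metric.tendstoUniformlyOn_iff.1 (hlim _ (he𝔖 _ k)) _ hpos
    obtain ⟨h, ⟨hhF, hh1⟩, hh2⟩ := ((Filter.Eventually.and h𝒰 h1).and h2).exists
    exact ⟨h, hhF, hh1, hh2⟩
  choose H HF Hx HS using hex
  obtain ⟨V, hV⟩ := exists_play fun L : List (Set X) =>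
    {z | dist ((H L).toC z) ((H L).toC x) < 1 / ((L.length : ℝ) + 1)}
  obtain ⟨hlegal, y, hyS, hyV⟩ := hs V fun n => by
    rw [hV n]
    exact ⟨isOpen_lt (by fun_prop) (by fun_prop), by
      rw [Set.mem_ofPred_eq, dist_self]; exact Nat.one_div_pos_of_nat⟩
  set h : ℕ → UniformOnC X ℝ 𝔖 := fun n => H ((List.range n).map V) with hh
  have hhx : ∀ n, dist (g x) ((h n).toC x) < 1 / ((n : ℝ) + 1) := fun n => by
    simpa using Hx ((List.range n).map V) x hxTx
  have hhy : ∀ n, dist ((h n).toC y) ((h n).toC x) < 1 / ((n : ℝ) + 1) := fun n => by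
    have := Set.mem_iInter.1 hyV n
    rw [hV n] at this
    simpa using this
  have hhS : ∀ i k, ∀ z ∈ e (s.answer V i) k, ∀ n, i < n → k < n →
      dist (g z) ((h n).toC z) < 1 / ((n : ℝ) + 1) := fun i k z hz n hi hk => by
    have := HS ((List.range n).map V) i (by simpa using hi) k (by simpa using hk) z (by
      rwa [← List.map_take, List.take_range, min_eq_left (by omega)])
    simpa using this
  obtain ⟨Ty, hTy, hyTy⟩ : y ∈ ⋃₀ 𝔖 := hcover ▸ Set.mem_univ y
  -- a continuous limit of `h` along a nonprincipal ultrafilter on `ℕ`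
  obtain ⟨f, hf⟩ := hF.exists_tendstoUniformlyOn
    (𝒰 := (hyperfilter ℕ).map h) (Filter.mem_map.2 (univ_mem' fun n => HF _))
    (𝒜 := insert Tx (insert Ty (Set.range fun p : ℕ × ℕ => e (s.answer V p.1) p.2)))
    (Set.insert_subset hTx (Set.insert_subset hTy (Set.range_subset_iff.2 fun p => he𝔖 _ _)))
    (((Set.countable_range _).insert _).insert _)
  have hpt : ∀ T ∈ insert Tx (insert Ty (Set.range fun p : ℕ × ℕ => e (s.answer V p.1) p.2)),
      ∀ z ∈ T, Tendsto (fun n => (h n).toC z) (hyperfilter ℕ) (𝓝 (f z)) := fun T hT z hz =>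
    ((hf T hT).tendsto_at hz).comp (tendsto_map (f := h) (x := (hyperfilter ℕ : Filter ℕ)))
  have hle : (hyperfilter ℕ : Filter ℕ) ≤ atTop := Nat.hyperfilter_le_atTop
  have hzero : Tendsto (fun n : ℕ => 1 / ((n : ℝ) + 1)) (hyperfilter ℕ) (𝓝 0) :=
    tendsto_one_div_add_atTop_nhds_zero_nat.mono_left hle
  have hfg : ∀ T ∈ insert Tx (insert Ty (Set.range fun p : ℕ × ℕ => e (s.answer V p.1) p.2)),
      ∀ z ∈ T, (∀ᶠ n : ℕ in atTop, dist (g z) ((h n).toC z) < 1 / ((n : ℝ) + 1)) → g z = f z := by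
    intro T hT z hz hev
    refine dist_le_zero.1 (le_of_tendsto_of_tendsto (tendsto_const_nhds.dist (hpt T hT z hz)) hzero
      ((hev.filter_mono hle).mono fun n hn => hn.le))
  have hfgx : g x = f x :=
    hfg Tx (Set.mem_insert _ _) x hxTx (Eventually.of_forall hhx)
  have hfyx : f y = f x := dist_le_zero.1 (le_of_tendsto_of_tendsto
    ((hpt Ty (Set.mem_insert_of_mem _ (Set.mem_insert _ _)) y hyTy).dist
      (hpt Tx (Set.mem_insert _ _) x hxTx)) hzero (Eventually.of_forall fun n => (hhy n).le))
  have hfgS : ∀ i, Set.EqOn g f (s.answer V i) := fun i =>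
    (eqOn_closure_of_forall_countable hcover hg (he𝔖 (s.answer V i)) fun z hz => by
      obtain ⟨k, hk⟩ := Set.mem_iUnion.1 hz
      refine hfg _ (Set.mem_insert_of_mem _ (Set.mem_insert_of_mem _ ⟨(i, k), rfl⟩)) z hk ?_
      filter_upwards [eventually_gt_atTop i, eventually_gt_atTop k] with n hi hk'
      exact hhS i k z hk n hi hk').mono (he _ (hlegal i).2)
  have hsub : (⋃ n, s.answer V n) ⊆ f ⁻¹' C := Set.iUnion_subset fun i z hz => by
    rw [Set.mem_preimage, ← hfgS i hz]
    exact (hlegal i).1 hz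
  refine hxA ?_
  rw [Set.mem_preimage, hfgx, ← hfyx]
  exact closure_minimal hsub (hC.preimage f.continuous) hyS

theorem theorem2p7 {X : Type*} [TopologicalSpace X] [T35Space X] (𝔖 : Set (Set X))
    (hcover : ⋃₀ 𝔖 = Set.univ) (hAV : IsAVSpace X (sigmaFamily 𝔖)) :
    IsMuSpace (UniformOnC X ℝ 𝔖) := by
  intro F hF
  refine isCompact_iff_ultrafilter_le_nhds'.2 fun 𝒰 h𝒰 => ?_
  have hF' := hF.closure
  have hpt : ∀ x, ∃ a, Tendsto (fun h : UniformOnC X ℝ 𝔖 => h.toC x) 𝒰 (𝓝 a) := fun x => by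
    obtain ⟨T, hT, hx⟩ : x ∈ ⋃₀ 𝔖 := hcover ▸ Set.mem_univ x
    obtain ⟨f, hf⟩ := hF'.exists_tendstoUniformlyOn h𝒰 (Set.singleton_subset_iff.2 hT)
      (Set.countable_singleton T)
    exact ⟨f x, (hf T rfl).tendsto_at hx⟩
  choose g hg using hpt
  -- limits on subfamilies agree with the pointwise limit
  have heq : ∀ {f : C(X, ℝ)} {T : Set X},
      TendstoUniformlyOn (fun (h : UniformOnC X ℝ 𝔖) x => h.toC x) f 𝒰 T → Set.EqOn g f T :=
    fun hf x hx => tendsto_nhds_unique (hg x) (hf.tendsto_at hx)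
  have hlim : ∀ T ∈ 𝔖,
      TendstoUniformlyOn (fun (h : UniformOnC X ℝ 𝔖) x => h.toC x) g 𝒰 T := fun T hT => by
    obtain ⟨f, hf⟩ := hF'.exists_tendstoUniformlyOn h𝒰 (Set.singleton_subset_iff.2 hT)
      (Set.countable_singleton T)
    exact (hf T rfl).congr_right (heq (hf T rfl)).symm
  have hcont : Continuous g := continuous_of_forall_countable hcover hAV hF' h𝒰 hlim
    fun 𝒜 h𝒜 hc => by
      obtain ⟨f, hf⟩ := hF'.exists_tendstoUniformlyOn h𝒰 h𝒜 hc
      exact ⟨f, fun x ⟨T, hT, hx⟩ => heq (hf T hT) hx⟩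
  let G : UniformOnC X ℝ 𝔖 := .ofC 𝔖 ⟨g, hcont⟩
  have hG : Tendsto id (𝒰 : Filter (UniformOnC X ℝ 𝔖)) (𝓝 G) :=
    UniformOnC.tendsto_iff_tendstoUniformlyOn.2 hlim
  exact ⟨G, isClosed_closure.mem_of_tendsto hG h𝒰, hG⟩
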